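/- Let $\alpha\in[0,1]$ and let $\varphi:\mathbb{R}\to\mathbb{R}$ be continuous and bounded. Call $u:[0,\infty)\times\mathbb{R}\to\mathbb{R}$ a solution of the transmission problem with initial datum $\varphi$ if (i) $u$ is of class $\mathcal{C}^{1,2}$ on $(0,\infty)\times(\mathbb{R}\setminus\{0\})$ (that is, $u$, $\partial_t u$, $\partial_x u$, $\partial_{xx}u$ exist and are jointly continuous there) and $u$ is continuous on $(0,\infty)\times\mathbb{R}$, so that $u(t,0+)=u(t,0-)$; (ii) $\partial_t u(t,x)=\tfrac12\,\partial_{xx}u(t,x)$ for all $t>0$ and $x\neq0$; (iii) for every $t>0$ the one-sided limits $\partial_x u(t,0+)$ and $\partial_x u(t,0-)$ exist and $\alpha\,\partial_x u(t,0+)=(1-\alpha)\,\partial_x u(t,0-)$; (iv) $u(0,x)=\varphi(x)$ and $u(t,x)\to\varphi(x)$ as $t\downarrow0$, for every $x\in\mathbb{R}$. Then there exists a solution $u$ that is continuous on $[0,\infty)\times\mathbb{R}$ and satisfies the maximum principle: for every constant $C$, if $\varphi\le C$ on $\mathbb{R}$ then $u\le C$ on $[0,\infty)\times\mathbb{R}$,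 and if $\varphi\ge C$ on $\mathbb{R}$ then $u\ge C$ on $[0,\infty)\times\mathbb{R}$. Moreover, $u$ is the only solution that is bounded on every strip $[0,T]\times\mathbb{R}$, $T>0$; in particular, it is the only solution that satisfies the maximum principle. -/

import Mathlib

open Set Filter Topology

namespace SkewHeat

/-- `u` is of class `C^{1,2}` on `(0,∞) × (ℝ \ {0})`: there `u`, `∂ₜu`, `∂ₓu` and `∂ₓₓu` exist and
are jointly continuous. -/
structure IsC12 (u : ℝ → ℝ → ℝ) : Prop where
  diff_t : ∀ t x : ℝ, 0 < t → x ≠ 0 → DifferentiableAt ℝ (fun s => u s x) t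
  diff_x : ∀ t x : ℝ, 0 < t → x ≠ 0 → DifferentiableAt ℝ (u t) x
  diff_xx : ∀ t x : ℝ, 0 < t → x ≠ 0 → DifferentiableAt ℝ (deriv (u t)) x
  cont : ContinuousOn (fun p : ℝ × ℝ => u p.1 p.2) (Ioi 0 ×ˢ {0}ᶜ)
  cont_t : ContinuousOn (fun p : ℝ × ℝ => deriv (fun s => u s p.2) p.1) (Ioi 0 ×ˢ {0}ᶜ)
  cont_x : ContinuousOn (fun p : ℝ × ℝ => deriv (u p.1) p.2) (Ioi 0 ×ˢ {0}ᶜ)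
  cont_xx : ContinuousOn (fun p : ℝ × ℝ => deriv (deriv (u p.1)) p.2) (Ioi 0 ×ˢ {0}ᶜ)

/-- Classical solution of the heat equation `∂ₜu = ½ ∂ₓₓu` on `(0,∞) × (ℝ \ {0})` with continuity
and the transmission condition of parameter `α` at `x = 0`, and with initial datum `φ`. Only the
values `u t x` with `t ≥ 0` matter. -/
structure IsSolution (α : ℝ) (φ : ℝ → ℝ) (u : ℝ → ℝ → ℝ) : Prop where
  c12 : IsC12 u
  /-- Joint continuity on `(0,∞) × ℝ`; in particular `u(t,0+) = u(t,0-)`. -/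
  cont : ContinuousOn (fun p : ℝ × ℝ => u p.1 p.2) (Ioi 0 ×ˢ univ)
  heat : ∀ t x : ℝ, 0 < t → x ≠ 0 →
    deriv (fun s => u s x) t = (1 / 2 : ℝ) * deriv (deriv (u t)) x
  /-- The one-sided limits `∂ₓu(t,0+)` and `∂ₓu(t,0-)` exist and
  `α ∂ₓu(t,0+) = (1 - α) ∂ₓu(t,0-)`. -/
  transmission : ∀ t : ℝ, 0 < t → ∃ dr dl : ℝ,
    Tendsto (deriv (u t)) (𝓝[>] 0) (𝓝 dr) ∧ Tendsto (deriv (u t)) (𝓝[<] 0) (𝓝 dl) ∧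
      α * dr = (1 - α) * dl
  initial : ∀ x : ℝ, u 0 x = φ x
  /-- The initial datum is attained as `t ↓ 0`. -/
  initial_limit : ∀ x : ℝ, Tendsto (fun t => u t x) (𝓝[>] 0) (𝓝 (φ x))

/-- The maximum principle: every upper (lower) bound of the datum `φ` is an upper (lower) bound
of `u` on `[0,∞) × ℝ`. -/
def MaximumPrinciple (φ : ℝ → ℝ) (u : ℝ → ℝ → ℝ) : Prop :=
  (∀ C : ℝ, (∀ x, φ x ≤ C) → ∀ t x : ℝ, 0 ≤ t → u t x ≤ C) ∧
  (∀ C : ℝ, (∀ x, C ≤ φ x) → ∀ t x : ℝ, 0 ≤ t → C ≤ u t x)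

/-- `u` is bounded on every strip `[0,T] × ℝ`. -/
def BoundedOnStrips (u : ℝ → ℝ → ℝ) : Prop :=
  ∀ T : ℝ, ∃ C : ℝ, ∀ t x : ℝ, 0 ≤ t → t ≤ T → |u t x| ≤ C

end SkewHeat

/-!
The evolution is explicit: it is the semigroup of skew Brownian motion, with transition density
`g_t(x - y) + (2α - 1) sgn(y) g_t(|x| + |y|)`, where `g_t` is the Gaussian density of variance `t`.
For `x ≥ 0`, reflecting the half-line `y < 0` turns the integral against this density into the
ordinary Gaussian evolution of a *folded* datum (`rightDatum`), which is again bounded and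
continuous; for `x ≤ 0` the same holds with `leftDatum`. Regularity, the heat equation and
continuity up to `t = 0` are thereby inherited from Gaussian averages (`hasDerivAt_scaledAvg_x`,
`hasDerivAt_scaledAvg_t`, `continuous_scaledAvg`). At `x = 0` only parity matters: an even
weight does not see the difference of the two folded data, which is odd, so the two halves agree;
the odd parts of the folded data are `2 (1 - α)` and `2 α` times that of the datum, which is the
transmission condition.

The maximum principle holds for every solution that is continuous up to `t = 0` and bounded on
strips: the barrier `x² - |x| + 2t + 1` excludes a positive maximum, its kink at the origin making
the transmission condition strict (`IsTransmissionFlow.le_barrier`).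

Uniqueness needs one more step, because a solution `v` attains its datum only pointwise. Restarted
at `s > 0` it is continuous up to the initial time, so the maximum principle identifies
`v (s + t)` with the evolution of `v s`; letting `s ↓ 0`, dominated convergence in the evolution
gives that `v t` is the evolution of `φ` (`IsSolution.eq_skewEvolution`).
-/

namespace SkewHeat
open MeasureTheory

/-! ### Flows through the transmission problem and the weak maximum principle -/

/-- A solution `w` of the transmission problem without reference to the attainment of its initial
datum, but continuous up to `t = 0`. The spatial derivatives are carried as explicit functions
`wx`, `wxx` (relevant only for `t > 0`, `x ≠ 0`), which makes the notion visibly linear. -/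
structure IsTransmissionFlow (α : ℝ) (w wx wxx : ℝ → ℝ → ℝ) : Prop where
  hasDerivAt_x : ∀ t x : ℝ, 0 < t → x ≠ 0 → HasDerivAt (w t) (wx t x) x
  hasDerivAt_xx : ∀ t x : ℝ, 0 < t → x ≠ 0 → HasDerivAt (wx t) (wxx t x) x
  hasDerivAt_t : ∀ t x : ℝ, 0 < t → x ≠ 0 →
    HasDerivAt (fun s => w s x) ((1 / 2 : ℝ) * wxx t x) t
  cont : ContinuousOn (fun p : ℝ × ℝ => w p.1 p.2) (Ici 0 ×ˢ univ)
  transmission : ∀ t : ℝ, 0 < t → ∃ dr dl : ℝ,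
    Tendsto (wx t) (𝓝[>] 0) (𝓝 dr) ∧ Tendsto (wx t) (𝓝[<] 0) (𝓝 dl) ∧
      α * dr = (1 - α) * dl

namespace IsTransmissionFlow

variable {α : ℝ} {w wx wxx v vx vxx : ℝ → ℝ → ℝ}

theorem sub (hw : IsTransmissionFlow α w wx wxx) (hv : IsTransmissionFlow α v vx vxx) :
    IsTransmissionFlow α (fun t x => w t x - v t x) (fun t x => wx t x - vx t x)
      (fun t x => wxx t x - vxx t x) where
  hasDerivAt_x t x ht hx := (hw.hasDerivAt_x t x ht hx).sub (hv.hasDerivAt_x t x ht hx)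
  hasDerivAt_xx t x ht hx := (hw.hasDerivAt_xx t x ht hx).sub (hv.hasDerivAt_xx t x ht hx)
  hasDerivAt_t t x ht hx := by
    rw [mul_sub]
    exact (hw.hasDerivAt_t t x ht hx).sub (hv.hasDerivAt_t t x ht hx)
  cont := hw.cont.sub hv.cont
  transmission t ht := by
    obtain ⟨dr, dl, hr, hl, h⟩ := hw.transmission t ht
    obtain ⟨er, el, kr, kl, k⟩ := hv.transmission t ht
    exact ⟨dr - er, dl - el, hr.sub kr, hl.sub kl, by linear_combination h - k⟩

theorem const (α C : ℝ) :
    IsTransmissionFlow α (fun _ _ => C) (fun _ _ => 0) (fun _ _ => 0) where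
  hasDerivAt_x _ _ _ _ := hasDerivAt_const _ _
  hasDerivAt_xx _ _ _ _ := hasDerivAt_const _ _
  hasDerivAt_t t _ _ _ := by simpa using hasDerivAt_const t C
  cont := continuousOn_const
  transmission _ _ := ⟨0, 0, tendsto_const_nhds, tendsto_const_nhds, by simp⟩

end IsTransmissionFlow

theorem nonpos_of_isLocalMax_of_hasDerivAt {f f' : ℝ → ℝ} {x d : ℝ} (hmax : IsLocalMax f x)
    (hf : ∀ᶠ y in 𝓝 x, HasDerivAt f (f' y) y) (hf' : HasDerivAt f' d x) : d ≤ 0 := by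
  by_contra! hd
  have hE : deriv f =ᶠ[𝓝 x] f' := hf.mono fun y hy => hy.deriv
  have hdd : deriv (deriv f) x = d := hE.deriv_eq.trans hf'.deriv
  have hmin : IsLocalMin f x := by
    apply isLocalMin_of_deriv_deriv_pos
    · rw [hdd]; exact hd
    · exact hmax.deriv_eq_zero
    · exact hf.self_of_nhds.continuousAt
  -- A point that is both a local maximum and a local minimum has vanishing second derivative.
  have hconst : f =ᶠ[𝓝 x] fun _ => f x := by
    filter_upwards [hmax, hmin] with y h1 h2 using le_antisymm h1 h2
  have h0 : deriv f =ᶠ[𝓝 x] fun _ => 0 := by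
    have := hconst.deriv
    simpa using this
  have h00 : deriv (deriv f) x = 0 := by rw [h0.deriv_eq]; simp
  linarith

theorem nonneg_of_hasDerivAt_of_le_left {f : ℝ → ℝ} {t d : ℝ} (ht : 0 < t)
    (hd : HasDerivAt f d t) (hle : ∀ s, 0 ≤ s → s ≤ t → f s ≤ f t) : 0 ≤ d := by
  have h : Tendsto (slope f t) (𝓝[<] t) (𝓝 d) :=
    (hasDerivAt_iff_tendsto_slope.1 hd).mono_left (nhdsWithin_mono _ fun y hy => ne_of_lt hy)
  refine ge_of_tendsto h ?_
  filter_upwards [Ioo_mem_nhdsLT ht] with s hs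
  rw [slope_def_field]
  exact div_nonneg_of_nonpos (by linarith [hle s hs.1.le hs.2.le]) (by linarith [hs.2])

theorem right_deriv_limit_nonpos_of_max {f f' : ℝ → ℝ} {d : ℝ} (hc : Continuous f)
    (hf : ∀ x, 0 < x → HasDerivAt f (f' x) x) (hlim : Tendsto f' (𝓝[>] 0) (𝓝 d))
    (hmax : ∀ x, f x ≤ f 0) : d ≤ 0 := by
  by_contra! hd
  obtain ⟨η, hη, hpos⟩ := mem_nhdsGT_iff_exists_Ioo_subset.1 (hlim.eventually (lt_mem_nhds hd))
  have hη0 : (0 : ℝ) < η := hη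
  have hmono : StrictMonoOn f (Icc 0 (η / 2)) := by
    apply strictMonoOn_of_deriv_pos (convex_Icc _ _) hc.continuousOn
    intro x hx
    rw [interior_Icc] at hx
    rw [(hf x hx.1).deriv]
    exact hpos ⟨hx.1, by linarith [hx.2]⟩
  have := hmono ⟨le_rfl, by linarith⟩ ⟨by linarith, le_rfl⟩ (by linarith : (0 : ℝ) < η / 2)
  linarith [hmax (η / 2)]

theorem left_deriv_limit_nonneg_of_max {f f' : ℝ → ℝ} {d : ℝ} (hc : Continuous f)
    (hf : ∀ x, x < 0 → HasDerivAt f (f' x) x) (hlim : Tendsto f' (𝓝[<] 0) (𝓝 d))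
    (hmax : ∀ x, f x ≤ f 0) : 0 ≤ d := by
  have hneg : Tendsto (fun x : ℝ => -x) (𝓝[>] 0) (𝓝[<] 0) := by
    have := tendsto_neg_nhdsGT (a := (0 : ℝ))
    rwa [neg_zero] at this
  have := right_deriv_limit_nonpos_of_max (f := fun x => f (-x)) (f' := fun x => -f' (-x))
    (d := -d) (hc.comp continuous_neg)
    (fun x hx => by
      have := (hf (-x) (by linarith)).comp x (hasDerivAt_neg x)
      simpa [Function.comp_def] using this)
    (hlim.comp hneg).neg (fun x => by simpa using hmax (-x))
  linarith

/-- The strict form of the weak maximum principle. The barrier `x² - |x| + 2t + 1` is positive,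
tends to infinity in space, is a strict supersolution of the heat equation, and its kink `-|x|`
makes the transmission inequality strict for every `α ∈ [0,1]`, including the end points. -/
theorem IsTransmissionFlow.le_barrier {α : ℝ} (hα : α ∈ Icc (0 : ℝ) 1) {w wx wxx : ℝ → ℝ → ℝ}
    (h : IsTransmissionFlow α w wx wxx) {T M : ℝ}
    (hM : ∀ t x, 0 ≤ t → t ≤ T → w t x ≤ M) (h0 : ∀ x, w 0 x ≤ 0) {δ : ℝ} (hδ : 0 < δ)
    {t x : ℝ} (ht : 0 ≤ t) (htT : t ≤ T) : w t x ≤ δ * (x ^ 2 - |x| + 2 * t + 1) := by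
  by_contra! hcon
  set z : ℝ → ℝ → ℝ := fun t x => w t x - δ * (x ^ 2 - |x| + 2 * t + 1) with hz
  have hzpos : 0 < z t x := by simp only [hz]; linarith
  set R : ℝ := 2 + |M| / δ + |x| with hR
  have hMδ : 0 ≤ |M| / δ := by positivity
  have hfar : ∀ s y, 0 ≤ s → s ≤ T → R ≤ |y| → z s y ≤ 0 := by
    intro s y hs hsT hy
    have h1 : |M| / δ ≤ y ^ 2 - |y| := by
      rw [← sq_abs y]
      nlinarith [abs_nonneg x, abs_nonneg y]
    have h2 : |M| ≤ δ * (y ^ 2 - |y|) := by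
      rwa [div_le_iff₀ hδ, mul_comm] at h1
    have h3 := hM s y hs hsT
    have h4 : 0 ≤ δ * (2 * s + 1) := by positivity
    simp only [hz]
    nlinarith [le_abs_self M]
  have hzc : ContinuousOn (fun p : ℝ × ℝ => z p.1 p.2) (Ici 0 ×ˢ univ) := by
    apply h.cont.sub
    fun_prop
  have hRx : |x| ≤ R := by simp only [hR]; linarith
  obtain ⟨⟨t₀, x₀⟩, ⟨⟨ht₀, ht₀T⟩, hx₀⟩, hmax⟩ :=
    (isCompact_Icc.prod isCompact_Icc : IsCompact (Icc 0 T ×ˢ Icc (-R) R)).exists_isMaxOn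
      ⟨(t, x), ⟨ht, htT⟩, abs_le.1 hRx⟩
      (hzc.mono (prod_mono (fun _ hs => hs.1) (subset_univ _)))
  have hz₀ : 0 < z t₀ x₀ := hzpos.trans_le (hmax (a := (t, x)) ⟨⟨ht, htT⟩, abs_le.1 hRx⟩)
  have hglob : ∀ s y, 0 ≤ s → s ≤ T → z s y ≤ z t₀ x₀ := by
    intro s y hs hsT
    rcases le_total R |y| with hy | hy
    · exact (hfar s y hs hsT hy).trans hz₀.le
    · exact hmax (a := (s, y)) ⟨⟨hs, hsT⟩, abs_le.1 hy⟩
  simp only at ht₀ ht₀T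
  have ht₀' : 0 < t₀ := by
    refine lt_of_le_of_ne ht₀ ?_
    rintro rfl
    have h1 : 0 ≤ x₀ ^ 2 - |x₀| + 2 * 0 + 1 := by
      rw [← sq_abs x₀]; nlinarith [sq_nonneg (|x₀| - 1)]
    have h2 := h0 x₀
    have h3 := mul_nonneg hδ.le h1
    simp only [hz] at hz₀
    linarith
  have hzx : ∀ y, y ≠ 0 → HasDerivAt (z t₀)
      (wx t₀ y - δ * (2 * y - (SignType.sign y : ℝ))) y := by
    intro y hy
    have h1 := ((((hasDerivAt_pow 2 y).sub (hasDerivAt_abs hy)).add_const (2 * t₀)).add_const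
      1).const_mul δ
    have h2 := (h.hasDerivAt_x t₀ y ht₀' hy).sub h1
    exact h2.congr_deriv (by simp)
  by_cases hx : x₀ = 0
  · subst hx
    obtain ⟨dr, dl, hr, hl, hd⟩ := h.transmission t₀ ht₀'
    have hcont : Continuous (z t₀) := by
      have : Continuous ((fun p : ℝ × ℝ => z p.1 p.2) ∘ fun y => (t₀, y)) :=
        hzc.comp_continuous (by fun_prop) fun y => ⟨ht₀, mem_univ _⟩
      exact this
    have h1 : dr - δ * (2 * 0 - 1) ≤ 0 := by
      refine right_deriv_limit_nonpos_of_max hcont (fun y hy => hzx y hy.ne') ?_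
        (fun y => hglob t₀ y ht₀ ht₀T)
      refine hr.sub (Tendsto.const_mul _ (Tendsto.sub ?_ ?_))
      · exact ((continuous_const.mul continuous_id).tendsto 0).mono_left nhdsWithin_le_nhds
      · refine tendsto_const_nhds.congr' ?_
        filter_upwards [self_mem_nhdsWithin] with y hy
        simp [sign_pos (show (0 : ℝ) < y from hy)]
    have h2 : 0 ≤ dl - δ * (2 * 0 - (-1)) := by
      refine left_deriv_limit_nonneg_of_max hcont (fun y hy => hzx y hy.ne) ?_
        (fun y => hglob t₀ y ht₀ ht₀T)
      refine hl.sub (Tendsto.const_mul _ (Tendsto.sub ?_ ?_))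
      · exact ((continuous_const.mul continuous_id).tendsto 0).mono_left nhdsWithin_le_nhds
      · refine tendsto_const_nhds.congr' ?_
        filter_upwards [self_mem_nhdsWithin] with y hy
        simp [sign_neg (show y < (0 : ℝ) from hy)]
    nlinarith [hα.1, hα.2, mul_nonneg hα.1 (neg_nonneg.2 h1),
      mul_nonneg (sub_nonneg.2 hα.2) h2]
  · have h1 : wxx t₀ x₀ - δ * 2 ≤ 0 := by
      refine nonpos_of_isLocalMax_of_hasDerivAt
        (Eventually.of_forall fun y => hglob t₀ y ht₀ ht₀T)
        ((eventually_ne_nhds hx).mono hzx) ?_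
      have hs : HasDerivAt (fun y : ℝ => (SignType.sign y : ℝ)) 0 x₀ := by
        refine (hasDerivAt_const x₀ (SignType.sign x₀ : ℝ)).congr_of_eventuallyEq ?_
        rcases lt_or_gt_of_ne hx with hx | hx
        · filter_upwards [gt_mem_nhds hx] with y hy
          rw [sign_neg hx, sign_neg hy]
        · filter_upwards [lt_mem_nhds hx] with y hy
          rw [sign_pos hx, sign_pos hy]
      have h3 := (h.hasDerivAt_xx t₀ x₀ ht₀' hx).sub
        ((((hasDerivAt_id x₀).const_mul 2).sub hs).const_mul δ)
      exact h3.congr_deriv (by simp)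
    have h2 : 0 ≤ (1 / 2 : ℝ) * wxx t₀ x₀ - δ * 2 := by
      refine nonneg_of_hasDerivAt_of_le_left (f := fun s => z s x₀) ht₀' ?_
        (fun s hs hst => hglob s x₀ hs (hst.trans ht₀T))
      have h3 := (h.hasDerivAt_t t₀ x₀ ht₀' hx).sub
        (((((hasDerivAt_id t₀).const_mul 2).const_add (x₀ ^ 2 - |x₀|)).add_const 1).const_mul δ)
      exact h3.congr_deriv (by simp)
    linarith

theorem IsTransmissionFlow.nonpos_of_initial_nonpos {α : ℝ} (hα : α ∈ Icc (0 : ℝ) 1)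
    {w wx wxx : ℝ → ℝ → ℝ} (h : IsTransmissionFlow α w wx wxx)
    (hM : ∀ T, ∃ M, ∀ t x, 0 ≤ t → t ≤ T → w t x ≤ M) (h0 : ∀ x, w 0 x ≤ 0)
    {t x : ℝ} (ht : 0 ≤ t) : w t x ≤ 0 := by
  obtain ⟨M, hM⟩ := hM t
  have hlim : Tendsto (fun δ : ℝ => δ * (x ^ 2 - |x| + 2 * t + 1)) (𝓝[>] 0) (𝓝 0) := by
    have : Tendsto (fun δ : ℝ => δ * (x ^ 2 - |x| + 2 * t + 1)) (𝓝 0)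
        (𝓝 (0 * (x ^ 2 - |x| + 2 * t + 1))) := tendsto_id.mul_const _
    rw [zero_mul] at this
    exact this.mono_left nhdsWithin_le_nhds
  refine ge_of_tendsto hlim ?_
  filter_upwards [self_mem_nhdsWithin] with δ hδ
  exact h.le_barrier hα hM h0 hδ ht le_rfl

/-- Two flows that are bounded on strips and start from the same datum coincide. -/
theorem IsTransmissionFlow.eq_of_initial_eq {α : ℝ} (hα : α ∈ Icc (0 : ℝ) 1)
    {w wx wxx v vx vxx : ℝ → ℝ → ℝ} (hw : IsTransmissionFlow α w wx wxx)
    (hv : IsTransmissionFlow α v vx vxx) (bw : BoundedOnStrips w) (bv : BoundedOnStrips v)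
    (h0 : ∀ x, w 0 x = v 0 x) {t x : ℝ} (ht : 0 ≤ t) : w t x = v t x := by
  have key : ∀ {w wx wxx v vx vxx : ℝ → ℝ → ℝ}, IsTransmissionFlow α w wx wxx →
      IsTransmissionFlow α v vx vxx → BoundedOnStrips w → BoundedOnStrips v →
      (∀ x, w 0 x = v 0 x) → w t x - v t x ≤ 0 := by
    intro w wx wxx v vx vxx hw hv bw bv h0
    refine (hw.sub hv).nonpos_of_initial_nonpos hα (fun T => ?_) (fun x => by simp [h0]) ht
    obtain ⟨A, hA⟩ := bw T
    obtain ⟨B, hB⟩ := bv T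
    refine ⟨A + B, fun t x ht htT => ?_⟩
    linarith [(abs_le.1 (hA t x ht htT)).2, (abs_le.1 (hB t x ht htT)).1]
  have h1 := key hw hv bw bv h0
  have h2 := key hv hw bv bw fun x => (h0 x).symm
  linarith

/-! ### Averages at the diffusive scale -/

/-- The average of `ψ` around `x` at scale `√t` with weight `κ`. Since `√t = 0` for `t ≤ 0`, it is
defined, and continuous, for all times. -/
noncomputable def scaledAvg (κ ψ : ℝ → ℝ) (t x : ℝ) : ℝ := ∫ z, ψ (x - √t * z) * κ z

/-- Gaussian decay of a weight, in the form used to dominate the derivatives of averages. -/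
def GaussianDecay (κ : ℝ → ℝ) : Prop := ∃ K, ∀ z, |κ z| ≤ K * Real.exp (-z ^ 2 / 4)

theorem integrable_exp_neg_sq_div {b : ℝ} (hb : 0 < b) :
    Integrable fun z : ℝ => Real.exp (-z ^ 2 / b) := by
  have := integrable_exp_neg_mul_sq (inv_pos.2 hb)
  refine this.congr (Eventually.of_forall fun z => ?_)
  simp only
  congr 1
  field_simp

theorem GaussianDecay.integrable {κ : ℝ → ℝ} (h : GaussianDecay κ) (hc : Continuous κ) :
    Integrable κ := by
  obtain ⟨K, hK⟩ := h
  exact ((integrable_exp_neg_sq_div (by norm_num : (0 : ℝ) < 4)).const_mul K).mono'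
    hc.aestronglyMeasurable (Eventually.of_forall hK)

theorem norm_mul_le_of_abs_le {a b M : ℝ} (h : |a| ≤ M) : ‖a * b‖ ≤ M * |b| := by
  rw [Real.norm_eq_abs, abs_mul]
  exact mul_le_mul_of_nonneg_right h (abs_nonneg b)

section Averages

variable {κ κ' ψ : ℝ → ℝ} {M : ℝ}

theorem integrable_scaledAvg (hκ : Integrable κ) (hψ : Continuous ψ) (hM : ∀ y, |ψ y| ≤ M)
    (t x : ℝ) : Integrable fun z => ψ (x - √t * z) * κ z :=
  (hκ.norm.const_mul M).mono'
    ((hψ.comp (by fun_prop)).aestronglyMeasurable.mul hκ.aestronglyMeasurable)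
    (Eventually.of_forall fun _ => norm_mul_le_of_abs_le (hM _))

theorem continuous_scaledAvg (hκ : Integrable κ) (hψ : Continuous ψ) (hM : ∀ y, |ψ y| ≤ M) :
    Continuous fun p : ℝ × ℝ => scaledAvg κ ψ p.1 p.2 := by
  refine continuous_of_dominated (bound := fun z => M * |κ z|) (fun p => ?_) (fun p => ?_)
    (hκ.norm.const_mul M) ?_
  · exact (integrable_scaledAvg hκ hψ hM p.1 p.2).aestronglyMeasurable
  · exact Eventually.of_forall fun _ => norm_mul_le_of_abs_le (hM _)
  · refine Eventually.of_forall fun z => ?_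
    exact (hψ.comp (by fun_prop)).mul continuous_const

theorem tendsto_scaledAvg {ι : Type*} {l : Filter ι} [l.IsCountablyGenerated] {Ψ : ι → ℝ → ℝ}
    (hκ : Integrable κ) (hΨ : ∀ᶠ i in l, Continuous (Ψ i))
    (hM : ∀ᶠ i in l, ∀ y, |Ψ i y| ≤ M) (hlim : ∀ y, Tendsto (fun i => Ψ i y) l (𝓝 (ψ y)))
    (t x : ℝ) : Tendsto (fun i => scaledAvg κ (Ψ i) t x) l (𝓝 (scaledAvg κ ψ t x)) := by
  refine tendsto_integral_filter_of_dominated_convergence (fun z => M * |κ z|) ?_ ?_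
    (hκ.norm.const_mul M) ?_
  · filter_upwards [hΨ, hM] with i h1 h2
    exact (integrable_scaledAvg hκ h1 h2 t x).aestronglyMeasurable
  · filter_upwards [hM] with i h2
    exact Eventually.of_forall fun _ => norm_mul_le_of_abs_le (h2 _)
  · exact Eventually.of_forall fun z => (hlim _).mul_const _

theorem scaledAvg_eq_conv (κ ψ : ℝ → ℝ) {t : ℝ} (ht : 0 < t) (x : ℝ) :
    scaledAvg κ ψ t x = (√t)⁻¹ * ∫ y, ψ (x - y) * κ ((√t)⁻¹ * y) := by
  have hs : 0 < √t := Real.sqrt_pos.2 ht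
  have := Measure.integral_comp_mul_left (fun y => ψ (x - y) * κ ((√t)⁻¹ * y)) (√t)
  rw [abs_of_pos (inv_pos.2 hs), smul_eq_mul] at this
  rw [← this, scaledAvg]
  congr 1
  ext z
  rw [inv_mul_cancel_left₀ hs.ne']

theorem scaledAvg_eq_conv' (κ ψ : ℝ → ℝ) {t : ℝ} (ht : 0 < t) (x : ℝ) :
    scaledAvg κ ψ t x = (√t)⁻¹ * ∫ y, ψ y * κ ((√t)⁻¹ * (x - y)) := by
  rw [scaledAvg_eq_conv κ ψ ht,
    ← integral_sub_left_eq_self (fun y => ψ y * κ ((√t)⁻¹ * (x - y))) volume x]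
  simp only [sub_sub_cancel]

/-- Spatial derivative of an average: it falls on the weight. -/
theorem hasDerivAt_scaledAvg_x (hκ : ∀ z, HasDerivAt κ (κ' z) z) (hκ'c : Continuous κ')
    (dκ : GaussianDecay κ) (dκ' : GaussianDecay κ') (hψ : Continuous ψ) (hM : ∀ y, |ψ y| ≤ M)
    {t : ℝ} (ht : 0 < t) (x : ℝ) :
    HasDerivAt (scaledAvg κ ψ t) ((√t)⁻¹ * scaledAvg κ' ψ t x) x := by
  have hκc : Continuous κ := continuous_iff_continuousAt.2 fun z => (hκ z).continuousAt
  obtain ⟨K, hK⟩ := dκ'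
  have hK0 : 0 ≤ K := by simpa using (abs_nonneg _).trans (hK 0)
  have hM0 : 0 ≤ M := (abs_nonneg _).trans (hM 0)
  have hr : 0 < (√t)⁻¹ := inv_pos.2 (Real.sqrt_pos.2 ht)
  set r := (√t)⁻¹ with hrdef
  have hint : Integrable fun y => ψ y * κ (r * (x - y)) := by
    refine Integrable.bdd_mul (c := M) ?_ hψ.aestronglyMeasurable (Eventually.of_forall hM)
    have := ((dκ.integrable hκc).comp_mul_left' hr.ne').comp_sub_left x
    exact this
  have key : HasDerivAt (fun x => ∫ y, ψ y * κ (r * (x - y)))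
      (∫ y, ψ y * (κ' (r * (x - y)) * r)) x := by
    refine (hasDerivAt_integral_of_dominated_loc_of_deriv_le (μ := volume)
      (F := fun x y => ψ y * κ (r * (x - y))) (F' := fun x y => ψ y * (κ' (r * (x - y)) * r))
      (bound := fun y => M * (K * Real.exp (r ^ 2 / 4) * r) * Real.exp (-(x - y) ^ 2 / (8 / r ^ 2)))
      (Metric.ball_mem_nhds x one_pos) ?_ hint ?_ ?_ ?_ ?_).2
    · exact Eventually.of_forall fun x' =>
        (hψ.mul (hκc.comp (by fun_prop))).aestronglyMeasurable
    · exact (hψ.mul ((hκ'c.comp (by fun_prop)).mul continuous_const)).aestronglyMeasurable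
    · refine Eventually.of_forall fun y x' hx' => ?_
      rw [Metric.mem_ball, Real.dist_eq] at hx'
      rw [Real.norm_eq_abs, abs_mul, abs_mul, abs_of_pos hr, mul_assoc M]
      refine mul_le_mul (hM y) ?_ (by positivity) hM0
      rw [mul_right_comm]
      refine mul_le_mul_of_nonneg_right ((hK _).trans ?_) hr.le
      rw [mul_assoc, ← Real.exp_add]
      refine mul_le_mul_of_nonneg_left (Real.exp_le_exp.2 ?_) hK0
      -- `(x - y)² ≤ 2 (x' - y)² + 2 (x' - x)²`, and the last term is at most `2`.
      have h1 : (x' - x) ^ 2 ≤ 1 := by rw [← sq_abs]; nlinarith [abs_nonneg (x' - x)]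
      have h2 : (x - y) ^ 2 ≤ 2 * (x' - y) ^ 2 + 2 := by nlinarith [sq_nonneg (x' - y + (x' - x))]
      have h3 : -(x - y) ^ 2 / (8 / r ^ 2) = -(r ^ 2 * (x - y) ^ 2) / 8 := by field_simp
      rw [h3]
      nlinarith [mul_le_mul_of_nonneg_left h2 (sq_nonneg r)]
    · refine Integrable.const_mul ?_ _
      exact (integrable_exp_neg_sq_div (by positivity : 0 < 8 / r ^ 2)).comp_sub_left x
    · refine Eventually.of_forall fun y x' _ => ?_
      have h1 : HasDerivAt (fun x => r * (x - y)) r x' := by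
        simpa using ((hasDerivAt_id x').sub_const y).const_mul r
      exact ((hκ _).comp x' h1).const_mul (ψ y)
  have h2 := key.const_mul r
  have e1 : scaledAvg κ ψ t = fun x => r * ∫ y, ψ y * κ (r * (x - y)) := by
    ext x'; exact scaledAvg_eq_conv' κ ψ ht x'
  rw [e1, scaledAvg_eq_conv' κ' ψ ht]
  refine h2.congr_deriv ?_
  congr 1
  rw [← integral_const_mul]
  congr 1
  ext y
  ring

/-- Time derivative of an average: differentiation in the inverse scale `r = 1 / √t` turns the
weight `κ` into `κ + z κ'`. -/
theorem hasDerivAt_scaledAvg_t (hκ : ∀ z, HasDerivAt κ (κ' z) z) (hκ'c : Continuous κ')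
    (dκ : GaussianDecay κ) (dκ' : GaussianDecay fun z => κ z + z * κ' z)
    (hψ : Continuous ψ) (hM : ∀ y, |ψ y| ≤ M) {t : ℝ} (ht : 0 < t) (x : ℝ) :
    HasDerivAt (fun s => scaledAvg κ ψ s x)
      (-(1 / (2 * t)) * scaledAvg (fun z => κ z + z * κ' z) ψ t x) t := by
  have hκc : Continuous κ := continuous_iff_continuousAt.2 fun z => (hκ z).continuousAt
  obtain ⟨K, hK⟩ := dκ'
  have hK0 : 0 ≤ K := by simpa using (abs_nonneg _).trans (hK 0)
  have hM0 : 0 ≤ M := (abs_nonneg _).trans (hM 0)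
  have hs : 0 < √t := Real.sqrt_pos.2 ht
  have hr : 0 < (√t)⁻¹ := inv_pos.2 hs
  have hψx : Continuous fun y => ψ (x - y) := hψ.comp (by fun_prop)
  have key : HasDerivAt (fun r => ∫ y, ψ (x - y) * (r * κ (r * y)))
      (∫ y, ψ (x - y) * (κ ((√t)⁻¹ * y) + (√t)⁻¹ * y * κ' ((√t)⁻¹ * y))) (√t)⁻¹ := by
    set r := (√t)⁻¹ with hrdef
    have hint : Integrable fun y => ψ (x - y) * (r * κ (r * y)) := by
      refine Integrable.bdd_mul (c := M) ?_ hψx.aestronglyMeasurable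
        (Eventually.of_forall fun y => hM _)
      exact ((dκ.integrable hκc).comp_mul_left' hr.ne').const_mul r
    refine (hasDerivAt_integral_of_dominated_loc_of_deriv_le (μ := volume)
      (F := fun r y => ψ (x - y) * (r * κ (r * y)))
      (F' := fun r y => ψ (x - y) * (κ (r * y) + r * y * κ' (r * y)))
      (bound := fun y => M * (K * Real.exp (-y ^ 2 / (16 / r ^ 2))))
      (Metric.ball_mem_nhds r (half_pos hr)) ?_ hint ?_ ?_ ?_ ?_).2
    · exact Eventually.of_forall fun r' =>
        (hψx.mul (continuous_const.mul (hκc.comp (by fun_prop)))).aestronglyMeasurable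
    · exact (hψx.mul ((hκc.comp (by fun_prop)).add
        ((continuous_const.mul continuous_id).mul (hκ'c.comp (by fun_prop))))).aestronglyMeasurable
    · refine Eventually.of_forall fun y r' hr' => ?_
      rw [Metric.mem_ball, Real.dist_eq] at hr'
      rw [Real.norm_eq_abs, abs_mul]
      refine mul_le_mul (hM _) ((hK (r' * y)).trans ?_) (abs_nonneg _) hM0
      refine mul_le_mul_of_nonneg_left (Real.exp_le_exp.2 ?_) hK0
      have h1 : r / 2 ≤ r' := by linarith [(abs_lt.1 hr').1]
      have h2 : (r / 2) ^ 2 ≤ r' ^ 2 := pow_le_pow_left₀ (by positivity) h1 2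
      have h3 : -y ^ 2 / (16 / r ^ 2) = -((r / 2) ^ 2 * y ^ 2) / 4 := by field_simp; ring
      rw [h3, mul_pow]
      have := mul_le_mul_of_nonneg_right h2 (sq_nonneg y)
      linarith
    · exact ((integrable_exp_neg_sq_div (by positivity : 0 < 16 / r ^ 2)).const_mul K).const_mul M
    · refine Eventually.of_forall fun y r' _ => ?_
      have h1 : HasDerivAt (fun r : ℝ => r * y) y r' := by
        simpa using (hasDerivAt_id r').mul_const y
      have h2 := ((hasDerivAt_id r').mul ((hκ _).comp r' h1)).const_mul (ψ (x - y))
      refine h2.congr_deriv ?_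
      simp only [id, Function.comp]
      ring
  have hinv : HasDerivAt (fun s => (√s)⁻¹) (-(1 / (2 * √t)) / √t ^ 2) t :=
    (Real.hasDerivAt_sqrt ht.ne').inv hs.ne'
  have h2 := HasDerivAt.comp (h₂ := fun r => ∫ y, ψ (x - y) * (r * κ (r * y)))
    (h := fun s => (√s)⁻¹) t key hinv
  have e1 : (fun s => scaledAvg κ ψ s x) =ᶠ[𝓝 t]
      (fun r => ∫ y, ψ (x - y) * (r * κ (r * y))) ∘ fun s => (√s)⁻¹ := by
    filter_upwards [lt_mem_nhds ht] with s hs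
    rw [scaledAvg_eq_conv κ ψ hs, ← integral_const_mul]
    simp only [Function.comp]
    congr 1
    ext y
    ring
  refine (h2.congr_of_eventuallyEq e1).congr_deriv ?_
  rw [scaledAvg_eq_conv _ ψ ht, Real.sq_sqrt ht.le]
  field_simp

theorem scaledAvg_reflect (κ ψ : ℝ → ℝ) (t : ℝ) :
    scaledAvg κ ψ t 0 = scaledAvg (fun z => κ (-z)) (fun y => ψ (-y)) t 0 := by
  rw [scaledAvg, ← integral_neg_eq_self]
  simp [scaledAvg]

end Averages

/-! ### The Gaussian weight and its derivatives -/

/-- The unnormalized Gaussian weight. -/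
noncomputable def gauss (z : ℝ) : ℝ := Real.exp (-z ^ 2 / 2)

/-- The first derivative of `gauss`. -/
noncomputable def gauss' (z : ℝ) : ℝ := -z * gauss z

/-- The second derivative of `gauss`. -/
noncomputable def gauss'' (z : ℝ) : ℝ := (z ^ 2 - 1) * gauss z

theorem continuous_gauss : Continuous gauss := by unfold gauss; fun_prop

theorem continuous_gauss' : Continuous gauss' := continuous_neg.mul continuous_gauss

theorem continuous_gauss'' : Continuous gauss'' :=
  ((continuous_pow 2).sub continuous_const).mul continuous_gauss

theorem hasDerivAt_gauss (z : ℝ) : HasDerivAt gauss (gauss' z) z := by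
  have h := (((hasDerivAt_pow 2 z).neg).div_const 2).exp
  refine h.congr_deriv ?_
  simp only [gauss', gauss, Pi.neg_apply]
  push_cast
  ring

theorem hasDerivAt_gauss' (z : ℝ) : HasDerivAt gauss' (gauss'' z) z := by
  have h := (hasDerivAt_neg z).mul (hasDerivAt_gauss z)
  refine h.congr_deriv ?_
  simp only [gauss'', gauss']
  ring

theorem gaussianDecay_mul_gauss {p : ℝ → ℝ} (hp : ∀ z, |p z| ≤ 1 + z ^ 2) :
    GaussianDecay fun z => p z * gauss z := by
  refine ⟨4, fun z => ?_⟩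
  have h1 : 1 + z ^ 2 ≤ 4 * Real.exp (z ^ 2 / 4) := by linarith [Real.add_one_le_exp (z ^ 2 / 4)]
  have h2 : gauss z = Real.exp (-z ^ 2 / 4) * Real.exp (-(z ^ 2 / 4)) := by
    rw [gauss, ← Real.exp_add]; congr 1; ring
  have h3 : Real.exp (z ^ 2 / 4) * Real.exp (-(z ^ 2 / 4)) = 1 := by
    rw [← Real.exp_add]; simp
  rw [abs_mul, abs_of_pos (show 0 < gauss z from Real.exp_pos _)]
  calc |p z| * gauss z ≤ 4 * Real.exp (z ^ 2 / 4) * gauss z :=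
        mul_le_mul_of_nonneg_right ((hp z).trans h1) (Real.exp_pos _).le
    _ = 4 * Real.exp (-z ^ 2 / 4) := by rw [h2]; linear_combination 4 * Real.exp (-z ^ 2 / 4) * h3

theorem gaussianDecay_gauss : GaussianDecay gauss := by
  have := gaussianDecay_mul_gauss (p := fun _ => 1) fun z => by
    rw [abs_one]; nlinarith [sq_nonneg z]
  simpa using this

theorem gaussianDecay_gauss' : GaussianDecay gauss' :=
  gaussianDecay_mul_gauss (p := fun z => -z) fun z => by
    rw [abs_neg]; nlinarith [sq_abs z, sq_nonneg (|z| - 1), abs_nonneg z]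

theorem gaussianDecay_gauss'' : GaussianDecay gauss'' :=
  gaussianDecay_mul_gauss (p := fun z => z ^ 2 - 1) fun z => by
    rw [abs_le]; constructor <;> nlinarith [sq_nonneg z]

theorem integrable_gauss : Integrable gauss := gaussianDecay_gauss.integrable continuous_gauss

theorem integrable_gauss' : Integrable gauss' := gaussianDecay_gauss'.integrable continuous_gauss'

theorem integrable_gauss'' : Integrable gauss'' :=
  gaussianDecay_gauss''.integrable continuous_gauss''

theorem integral_gauss : ∫ z, gauss z = √(2 * Real.pi) := by
  have := integral_gaussian (1 / 2)
  rw [show Real.pi / (1 / 2) = 2 * Real.pi by ring] at this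
  rw [← this]
  congr 1
  ext z
  rw [gauss]
  congr 1
  ring

/-- The Gaussian weight satisfies `κ + z κ' = -κ''`; this is the heat equation. -/
theorem hasDerivAt_scaledAvg_gauss_t {ψ : ℝ → ℝ} {M : ℝ} (hψ : Continuous ψ)
    (hM : ∀ y, |ψ y| ≤ M) {t : ℝ} (ht : 0 < t) (x : ℝ) :
    HasDerivAt (fun s => scaledAvg gauss ψ s x)
      (1 / 2 * (t⁻¹ * scaledAvg gauss'' ψ t x)) t := by
  have e : (fun z => gauss z + z * gauss' z) = fun z => (1 - z ^ 2) * gauss z := by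
    ext z; simp only [gauss']; ring
  have d : GaussianDecay fun z => gauss z + z * gauss' z := by
    rw [e]
    exact gaussianDecay_mul_gauss (p := fun z => 1 - z ^ 2) fun z => by
      rw [abs_le]; constructor <;> nlinarith [sq_nonneg z]
  refine (hasDerivAt_scaledAvg_t hasDerivAt_gauss continuous_gauss' gaussianDecay_gauss d
    hψ hM ht x).congr_deriv ?_
  have e2 : scaledAvg (fun z => gauss z + z * gauss' z) ψ t x = -scaledAvg gauss'' ψ t x := by
    rw [e, scaledAvg, scaledAvg, ← integral_neg]
    congr 1
    ext z
    simp only [gauss'']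
    ring
  rw [e2]
  field_simp

/-! ### Folded data and the explicit solution -/

/-- The datum on the line whose Gaussian evolution gives the solution on `x ≥ 0`. It equals `ψ y`
for `y ≥ 0` and `2 (1 - α) ψ y + (2 α - 1) ψ (-y)` for `y ≤ 0`; `min` makes continuity evident. -/
def rightDatum (α : ℝ) (ψ : ℝ → ℝ) (y : ℝ) : ℝ :=
  ψ y + (2 * α - 1) * (ψ (-min y 0) - ψ (min y 0))

/-- The datum on the line whose Gaussian evolution gives the solution on `x ≤ 0`. It equals `ψ y`
for `y ≤ 0` and `2 α ψ y - (2 α - 1) ψ (-y)` for `y ≥ 0`. -/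
def leftDatum (α : ℝ) (ψ : ℝ → ℝ) (y : ℝ) : ℝ :=
  ψ y - (2 * α - 1) * (ψ (-max y 0) - ψ (max y 0))

section Data

variable {α M : ℝ} {ψ : ℝ → ℝ}

theorem continuous_rightDatum (α : ℝ) (hψ : Continuous ψ) : Continuous (rightDatum α ψ) :=
  hψ.add (continuous_const.mul ((hψ.comp (by fun_prop)).sub (hψ.comp (by fun_prop))))

theorem continuous_leftDatum (α : ℝ) (hψ : Continuous ψ) : Continuous (leftDatum α ψ) :=
  hψ.sub (continuous_const.mul ((hψ.comp (by fun_prop)).sub (hψ.comp (by fun_prop))))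

theorem abs_mul_sub_le (hα : α ∈ Icc (0 : ℝ) 1) (hM : ∀ y, |ψ y| ≤ M) (a b : ℝ) :
    |(2 * α - 1) * (ψ a - ψ b)| ≤ 2 * M := by
  have h1 : |2 * α - 1| ≤ 1 := abs_le.2 ⟨by linarith [hα.1], by linarith [hα.2]⟩
  have h2 : |ψ a - ψ b| ≤ 2 * M := (abs_sub _ _).trans (by linarith [hM a, hM b])
  rw [abs_mul]
  nlinarith [abs_nonneg (ψ a - ψ b)]

theorem abs_rightDatum_le (hα : α ∈ Icc (0 : ℝ) 1) (hM : ∀ y, |ψ y| ≤ M) (y : ℝ) :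
    |rightDatum α ψ y| ≤ 3 * M :=
  (abs_add_le _ _).trans (by linarith [hM y, abs_mul_sub_le hα hM (-min y 0) (min y 0)])

theorem abs_leftDatum_le (hα : α ∈ Icc (0 : ℝ) 1) (hM : ∀ y, |ψ y| ≤ M) (y : ℝ) :
    |leftDatum α ψ y| ≤ 3 * M :=
  (abs_sub _ _).trans (by linarith [hM y, abs_mul_sub_le hα hM (-max y 0) (max y 0)])

theorem rightDatum_of_nonneg {y : ℝ} (hy : 0 ≤ y) : rightDatum α ψ y = ψ y := by
  simp [rightDatum, min_eq_right hy]

theorem rightDatum_of_nonpos {y : ℝ} (hy : y ≤ 0) :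
    rightDatum α ψ y = ψ y + (2 * α - 1) * (ψ (-y) - ψ y) := by
  simp [rightDatum, min_eq_left hy]

theorem leftDatum_of_nonpos {y : ℝ} (hy : y ≤ 0) : leftDatum α ψ y = ψ y := by
  simp [leftDatum, max_eq_right hy]

theorem leftDatum_of_nonneg {y : ℝ} (hy : 0 ≤ y) :
    leftDatum α ψ y = ψ y - (2 * α - 1) * (ψ (-y) - ψ y) := by
  simp [leftDatum, max_eq_left hy]

theorem rightDatum_sub_leftDatum (α : ℝ) (ψ : ℝ → ℝ) (y : ℝ) :
    rightDatum α ψ y - leftDatum α ψ y = (2 * α - 1) * (ψ (-y) - ψ y) := by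
  rcases le_total 0 y with hy | hy
  · rw [rightDatum_of_nonneg hy, leftDatum_of_nonneg hy]; ring
  · rw [rightDatum_of_nonpos hy, leftDatum_of_nonpos hy]; ring

theorem rightDatum_sub_reflect (α : ℝ) (ψ : ℝ → ℝ) (y : ℝ) :
    rightDatum α ψ y - rightDatum α ψ (-y) = 2 * (1 - α) * (ψ y - ψ (-y)) := by
  rcases le_total 0 y with hy | hy
  · rw [rightDatum_of_nonneg hy, rightDatum_of_nonpos (neg_nonpos.2 hy), neg_neg]; ring
  · rw [rightDatum_of_nonpos hy, rightDatum_of_nonneg (neg_nonneg.2 hy)]; ring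

theorem leftDatum_sub_reflect (α : ℝ) (ψ : ℝ → ℝ) (y : ℝ) :
    leftDatum α ψ y - leftDatum α ψ (-y) = 2 * α * (ψ y - ψ (-y)) := by
  rcases le_total 0 y with hy | hy
  · rw [leftDatum_of_nonneg hy, leftDatum_of_nonpos (neg_nonpos.2 hy)]; ring
  · rw [leftDatum_of_nonpos hy, leftDatum_of_nonneg (neg_nonneg.2 hy), neg_neg]; ring

end Data

section AtOrigin

variable {κ f g : ℝ → ℝ} {A B : ℝ}

theorem scaledAvg_sub_const_mul (hκ : Integrable κ) (hf : Continuous f) (hg : Continuous g)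
    (hA : ∀ y, |f y| ≤ A) (hB : ∀ y, |g y| ≤ B) (c t x : ℝ) :
    scaledAvg κ (fun y => f y - c * g y) t x = scaledAvg κ f t x - c * scaledAvg κ g t x := by
  rw [scaledAvg, scaledAvg, scaledAvg, ← integral_const_mul, ← integral_sub
    (integrable_scaledAvg hκ hf hA t x) ((integrable_scaledAvg hκ hg hB t x).const_mul c)]
  congr 1
  ext z
  ring

/-- At the origin an even weight only sees the even part of the datum. -/
theorem scaledAvg_zero_eq_of_even (hκ : Integrable κ) (hf : Continuous f) (hg : Continuous g)
    (hA : ∀ y, |f y| ≤ A) (hB : ∀ y, |g y| ≤ B) (heven : ∀ z, κ (-z) = κ z)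
    (h : ∀ y, f y - g y = -(f (-y) - g (-y))) (t : ℝ) :
    scaledAvg κ f t 0 = scaledAvg κ g t 0 := by
  have h1 := scaledAvg_sub_const_mul hκ hf hg hA hB 1 t 0
  have h2 : scaledAvg κ (fun y => f y - 1 * g y) t 0
      = -scaledAvg κ (fun y => f y - 1 * g y) t 0 := by
    nth_rw 1 [scaledAvg_reflect]
    rw [scaledAvg, scaledAvg, ← integral_neg]
    congr 1
    ext z
    rw [heven]
    have := h (0 - √t * z)
    linear_combination κ z * this
  linarith

/-- At the origin an odd weight only sees the odd part of the datum. -/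
theorem scaledAvg_zero_eq_of_odd (hκ : Integrable κ) (hf : Continuous f) (hg : Continuous g)
    (hA : ∀ y, |f y| ≤ A) (hB : ∀ y, |g y| ≤ B) (hodd : ∀ z, κ (-z) = -κ z) {c : ℝ}
    (h : ∀ y, f y - f (-y) = c * (g y - g (-y))) (t : ℝ) :
    scaledAvg κ f t 0 = c * scaledAvg κ g t 0 := by
  have h1 := scaledAvg_sub_const_mul hκ hf hg hA hB c t 0
  have h2 : scaledAvg κ (fun y => f y - c * g y) t 0
      = -scaledAvg κ (fun y => f y - c * g y) t 0 := by
    nth_rw 1 [scaledAvg_reflect]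
    rw [scaledAvg, scaledAvg, ← integral_neg]
    congr 1
    ext z
    rw [hodd]
    have := h (0 - √t * z)
    linear_combination κ z * this
  linarith

end AtOrigin

/-- The function equal to `F` for `x ≥ 0` and to `G` for `x < 0`, normalized by the total mass
`√(2π)` of `gauss`. -/
noncomputable def glue (F G : ℝ → ℝ → ℝ) (t x : ℝ) : ℝ :=
  (√(2 * Real.pi))⁻¹ * if 0 ≤ x then F t x else G t x

theorem sqrt_two_pi_pos : 0 < √(2 * Real.pi) := Real.sqrt_pos.2 (by positivity)

section Glue

variable {F G F' G' : ℝ → ℝ → ℝ} {t x : ℝ}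

theorem glue_eventuallyEq_of_pos (F G : ℝ → ℝ → ℝ) (hx : 0 < x) :
    ∀ᶠ y in 𝓝 x, ∀ t, glue F G t y = (√(2 * Real.pi))⁻¹ * F t y := by
  filter_upwards [lt_mem_nhds hx] with y hy t
  rw [glue, if_pos hy.le]

theorem glue_eventuallyEq_of_neg (F G : ℝ → ℝ → ℝ) (hx : x < 0) :
    ∀ᶠ y in 𝓝 x, ∀ t, glue F G t y = (√(2 * Real.pi))⁻¹ * G t y := by
  filter_upwards [gt_mem_nhds hx] with y hy t
  rw [glue, if_neg hy.not_ge]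

theorem hasDerivAt_glue_x (hx : x ≠ 0) (hF : HasDerivAt (F t) (F' t x) x)
    (hG : HasDerivAt (G t) (G' t x) x) : HasDerivAt (glue F G t) (glue F' G' t x) x := by
  rcases lt_or_gt_of_ne hx with hx | hx
  · rw [(glue_eventuallyEq_of_neg F' G' hx).self_of_nhds t]
    exact (hG.const_mul _).congr_of_eventuallyEq
      ((glue_eventuallyEq_of_neg F G hx).mono fun y h => h t)
  · rw [(glue_eventuallyEq_of_pos F' G' hx).self_of_nhds t]
    exact (hF.const_mul _).congr_of_eventuallyEq
      ((glue_eventuallyEq_of_pos F G hx).mono fun y h => h t)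

theorem hasDerivAt_glue_t {c : ℝ} (hF : HasDerivAt (fun s => F s x) (c * F' t x) t)
    (hG : HasDerivAt (fun s => G s x) (c * G' t x) t) :
    HasDerivAt (fun s => glue F G s x) (c * glue F' G' t x) t := by
  unfold glue
  split_ifs
  · exact (hF.const_mul _).congr_deriv (by ring)
  · exact (hG.const_mul _).congr_deriv (by ring)

theorem continuousOn_glue
    (hF : ContinuousOn (fun p : ℝ × ℝ => F p.1 p.2) (Ioi 0 ×ˢ univ))
    (hG : ContinuousOn (fun p : ℝ × ℝ => G p.1 p.2) (Ioi 0 ×ˢ univ)) :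
    ContinuousOn (fun p : ℝ × ℝ => glue F G p.1 p.2) (Ioi 0 ×ˢ {0}ᶜ) := by
  rintro ⟨t, x⟩ ⟨ht, hx⟩
  have hmem : (Ioi 0 ×ˢ univ : Set (ℝ × ℝ)) ∈ 𝓝 (t, x) := prod_mem_nhds (Ioi_mem_nhds ht) univ_mem
  refine ContinuousAt.continuousWithinAt ?_
  rcases lt_or_gt_of_ne (show x ≠ 0 from hx) with hx | hx
  · refine ((hG.continuousAt hmem).const_mul (√(2 * Real.pi))⁻¹).congr ?_
    filter_upwards [continuousAt_snd.eventually (glue_eventuallyEq_of_neg F G hx)] with p h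
    exact (h p.1).symm
  · refine ((hF.continuousAt hmem).const_mul (√(2 * Real.pi))⁻¹).congr ?_
    filter_upwards [continuousAt_snd.eventually (glue_eventuallyEq_of_pos F G hx)] with p h
    exact (h p.1).symm

theorem continuous_glue (hF : Continuous fun p : ℝ × ℝ => F p.1 p.2)
    (hG : Continuous fun p : ℝ × ℝ => G p.1 p.2) (h0 : ∀ t, F t 0 = G t 0) :
    Continuous fun p : ℝ × ℝ => glue F G p.1 p.2 := by
  refine continuous_const.mul (Continuous.if_le hF hG continuous_const continuous_snd ?_)
  rintro ⟨t, x⟩ (rfl : 0 = x)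
  exact h0 t

theorem tendsto_glue_right (hF : Continuous (F t)) :
    Tendsto (glue F G t) (𝓝[>] 0) (𝓝 ((√(2 * Real.pi))⁻¹ * F t 0)) := by
  refine (((hF.tendsto 0).mono_left nhdsWithin_le_nhds).const_mul _).congr' ?_
  filter_upwards [self_mem_nhdsWithin] with y hy
  rw [glue, if_pos (le_of_lt hy)]

theorem tendsto_glue_left (hG : Continuous (G t)) :
    Tendsto (glue F G t) (𝓝[<] 0) (𝓝 ((√(2 * Real.pi))⁻¹ * G t 0)) := by
  refine (((hG.tendsto 0).mono_left nhdsWithin_le_nhds).const_mul _).congr' ?_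
  filter_upwards [self_mem_nhdsWithin] with y hy
  rw [glue, if_neg (not_le_of_gt hy)]

end Glue

/-- The semigroup of skew Brownian motion applied to `ψ`: on each half-line it is the Gaussian
evolution of the corresponding folded datum. -/
noncomputable def skewEvolution (α : ℝ) (ψ : ℝ → ℝ) : ℝ → ℝ → ℝ :=
  glue (scaledAvg gauss (rightDatum α ψ)) (scaledAvg gauss (leftDatum α ψ))

/-- The spatial derivative of `skewEvolution` away from the origin. -/
noncomputable def skewEvolutionX (α : ℝ) (ψ : ℝ → ℝ) : ℝ → ℝ → ℝ :=
  glue (fun t x => (√t)⁻¹ * scaledAvg gauss' (rightDatum α ψ) t x)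
    (fun t x => (√t)⁻¹ * scaledAvg gauss' (leftDatum α ψ) t x)

/-- The second spatial derivative of `skewEvolution` away from the origin. -/
noncomputable def skewEvolutionXX (α : ℝ) (ψ : ℝ → ℝ) : ℝ → ℝ → ℝ :=
  glue (fun t x => t⁻¹ * scaledAvg gauss'' (rightDatum α ψ) t x)
    (fun t x => t⁻¹ * scaledAvg gauss'' (leftDatum α ψ) t x)

section Evolution

variable {α M : ℝ} {ψ : ℝ → ℝ}

theorem continuous_skewEvolution (hα : α ∈ Icc (0 : ℝ) 1) (hψ : Continuous ψ)
    (hM : ∀ y, |ψ y| ≤ M) : Continuous fun p : ℝ × ℝ => skewEvolution α ψ p.1 p.2 := by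
  refine continuous_glue
    (continuous_scaledAvg integrable_gauss (continuous_rightDatum α hψ) (abs_rightDatum_le hα hM))
    (continuous_scaledAvg integrable_gauss (continuous_leftDatum α hψ) (abs_leftDatum_le hα hM))
    (scaledAvg_zero_eq_of_even integrable_gauss (continuous_rightDatum α hψ)
      (continuous_leftDatum α hψ) (abs_rightDatum_le hα hM) (abs_leftDatum_le hα hM)
      (fun z => by simp [gauss]) fun y => ?_)
  rw [rightDatum_sub_leftDatum, rightDatum_sub_leftDatum, neg_neg]
  ring

theorem continuousOn_skewEvolutionX (hα : α ∈ Icc (0 : ℝ) 1) (hψ : Continuous ψ)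
    (hM : ∀ y, |ψ y| ≤ M) :
    ContinuousOn (fun p : ℝ × ℝ => skewEvolutionX α ψ p.1 p.2) (Ioi 0 ×ˢ {0}ᶜ) := by
  have hs : ContinuousOn (fun p : ℝ × ℝ => (√p.1)⁻¹) (Ioi 0 ×ˢ univ) :=
    ContinuousOn.inv₀ (by fun_prop) fun p hp => (Real.sqrt_pos.2 hp.1).ne'
  exact continuousOn_glue
    (hs.mul (continuous_scaledAvg integrable_gauss' (continuous_rightDatum α hψ)
      (abs_rightDatum_le hα hM)).continuousOn)
    (hs.mul (continuous_scaledAvg integrable_gauss' (continuous_leftDatum α hψ)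
      (abs_leftDatum_le hα hM)).continuousOn)

theorem continuousOn_skewEvolutionXX (hα : α ∈ Icc (0 : ℝ) 1) (hψ : Continuous ψ)
    (hM : ∀ y, |ψ y| ≤ M) :
    ContinuousOn (fun p : ℝ × ℝ => skewEvolutionXX α ψ p.1 p.2) (Ioi 0 ×ˢ {0}ᶜ) := by
  have hs : ContinuousOn (fun p : ℝ × ℝ => p.1⁻¹) (Ioi 0 ×ˢ univ) :=
    ContinuousOn.inv₀ (by fun_prop) fun p hp => ne_of_gt hp.1
  exact continuousOn_glue
    (hs.mul (continuous_scaledAvg integrable_gauss'' (continuous_rightDatum α hψ)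
      (abs_rightDatum_le hα hM)).continuousOn)
    (hs.mul (continuous_scaledAvg integrable_gauss'' (continuous_leftDatum α hψ)
      (abs_leftDatum_le hα hM)).continuousOn)

theorem hasDerivAt_scaledAvg_gauss'_x (hψ : Continuous ψ) (hM : ∀ y, |ψ y| ≤ M) {t : ℝ}
    (ht : 0 < t) (x : ℝ) :
    HasDerivAt (fun x => (√t)⁻¹ * scaledAvg gauss' ψ t x) (t⁻¹ * scaledAvg gauss'' ψ t x) x := by
  refine ((hasDerivAt_scaledAvg_x hasDerivAt_gauss' continuous_gauss'' gaussianDecay_gauss'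
    gaussianDecay_gauss'' hψ hM ht x).const_mul _).congr_deriv ?_
  rw [← mul_assoc, ← mul_inv, Real.mul_self_sqrt ht.le]

theorem isTransmissionFlow_skewEvolution (hα : α ∈ Icc (0 : ℝ) 1) (hψ : Continuous ψ)
    (hM : ∀ y, |ψ y| ≤ M) :
    IsTransmissionFlow α (skewEvolution α ψ) (skewEvolutionX α ψ) (skewEvolutionXX α ψ) := by
  have cr := continuous_rightDatum α hψ
  have cl := continuous_leftDatum α hψ
  have br := abs_rightDatum_le hα hM
  have bl := abs_leftDatum_le hα hM
  refine ⟨fun t x ht hx => ?_, fun t x ht hx => ?_, fun t x ht hx => ?_,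
    (continuous_skewEvolution hα hψ hM).continuousOn, fun t ht => ?_⟩
  · exact hasDerivAt_glue_x hx
      (hasDerivAt_scaledAvg_x hasDerivAt_gauss continuous_gauss' gaussianDecay_gauss
        gaussianDecay_gauss' cr br ht x)
      (hasDerivAt_scaledAvg_x hasDerivAt_gauss continuous_gauss' gaussianDecay_gauss
        gaussianDecay_gauss' cl bl ht x)
  · exact hasDerivAt_glue_x hx (hasDerivAt_scaledAvg_gauss'_x cr br ht x)
      (hasDerivAt_scaledAvg_gauss'_x cl bl ht x)
  · exact hasDerivAt_glue_t (hasDerivAt_scaledAvg_gauss_t cr br ht x)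
      (hasDerivAt_scaledAvg_gauss_t cl bl ht x)
  · have hcont : ∀ {f : ℝ → ℝ}, Continuous f → (∀ y, |f y| ≤ 3 * M) →
        Continuous fun x => (√t)⁻¹ * scaledAvg gauss' f t x := fun hf hb =>
      continuous_const.mul ((continuous_scaledAvg integrable_gauss' hf hb).comp
        (by fun_prop : Continuous fun x : ℝ => (t, x)))
    have hodd : ∀ z, gauss' (-z) = -gauss' z := fun z => by simp [gauss', gauss]
    refine ⟨_, _, tendsto_glue_right (hcont cr br), tendsto_glue_left (hcont cl bl), ?_⟩
    rw [scaledAvg_zero_eq_of_odd integrable_gauss' cr hψ br hM hodd (rightDatum_sub_reflect α ψ),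
      scaledAvg_zero_eq_of_odd integrable_gauss' cl hψ bl hM hodd (leftDatum_sub_reflect α ψ)]
    ring

theorem scaledAvg_gauss_zero (f : ℝ → ℝ) (x : ℝ) :
    scaledAvg gauss f 0 x = √(2 * Real.pi) * f x := by
  simp only [scaledAvg, Real.sqrt_zero, zero_mul, sub_zero]
  rw [integral_const_mul, integral_gauss, mul_comm]

theorem skewEvolution_zero (α : ℝ) (ψ : ℝ → ℝ) (x : ℝ) : skewEvolution α ψ 0 x = ψ x := by
  rw [skewEvolution, glue, scaledAvg_gauss_zero, scaledAvg_gauss_zero]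
  split_ifs with hx
  · rw [rightDatum_of_nonneg hx, inv_mul_cancel_left₀ sqrt_two_pi_pos.ne']
  · rw [leftDatum_of_nonpos (not_le.1 hx).le, inv_mul_cancel_left₀ sqrt_two_pi_pos.ne']

theorem abs_scaledAvg_le {κ f : ℝ → ℝ} {A : ℝ} (hκ : Integrable κ) (hA : ∀ y, |f y| ≤ A)
    (t x : ℝ) : |scaledAvg κ f t x| ≤ ∫ z, A * |κ z| :=
  norm_integral_le_of_norm_le (hκ.norm.const_mul A)
    (Eventually.of_forall fun _ => norm_mul_le_of_abs_le (hA _))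

theorem boundedOnStrips_skewEvolution (hα : α ∈ Icc (0 : ℝ) 1) (hM : ∀ y, |ψ y| ≤ M) :
    BoundedOnStrips (skewEvolution α ψ) := by
  refine fun T => ⟨(√(2 * Real.pi))⁻¹ * ∫ z, 3 * M * |gauss z|, fun t x _ _ => ?_⟩
  have hc := inv_pos.2 sqrt_two_pi_pos
  rw [skewEvolution, glue, abs_mul, abs_of_pos hc]
  refine mul_le_mul_of_nonneg_left ?_ hc.le
  split_ifs
  · exact abs_scaledAvg_le integrable_gauss (abs_rightDatum_le hα hM) t x
  · exact abs_scaledAvg_le integrable_gauss (abs_leftDatum_le hα hM) t x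

theorem maximumPrinciple_skewEvolution (hα : α ∈ Icc (0 : ℝ) 1) (hψ : Continuous ψ)
    (hM : ∀ y, |ψ y| ≤ M) : MaximumPrinciple ψ (skewEvolution α ψ) := by
  have hu := isTransmissionFlow_skewEvolution hα hψ hM
  have hb := boundedOnStrips_skewEvolution hα hM
  refine ⟨fun C hC t x ht => ?_, fun C hC t x ht => ?_⟩
  · have := (hu.sub (.const α C)).nonpos_of_initial_nonpos hα (fun T => ?_)
      (fun x => by simpa [skewEvolution_zero] using hC x) (x := x) ht
    · linarith
    · obtain ⟨B, hB⟩ := hb T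
      exact ⟨B - C, fun t x ht htT => sub_le_sub_right (abs_le.1 (hB t x ht htT)).2 C⟩
  · have := ((IsTransmissionFlow.const α C).sub hu).nonpos_of_initial_nonpos hα (fun T => ?_)
      (fun x => by simpa [skewEvolution_zero] using hC x) (x := x) ht
    · linarith
    · obtain ⟨B, hB⟩ := hb T
      exact ⟨C + B, fun t x ht htT => by linarith [(abs_le.1 (hB t x ht htT)).1]⟩

/-- The evolution depends continuously on the datum under bounded pointwise convergence. -/
theorem tendsto_skewEvolution {ι : Type*} {l : Filter ι} [l.IsCountablyGenerated]
    {Ψ : ι → ℝ → ℝ} (hα : α ∈ Icc (0 : ℝ) 1) (hΨ : ∀ᶠ i in l, Continuous (Ψ i))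
    (hM : ∀ᶠ i in l, ∀ y, |Ψ i y| ≤ M) (hlim : ∀ y, Tendsto (fun i => Ψ i y) l (𝓝 (ψ y)))
    (t x : ℝ) : Tendsto (fun i => skewEvolution α (Ψ i) t x) l (𝓝 (skewEvolution α ψ t x)) := by
  unfold skewEvolution glue
  refine Tendsto.const_mul _ ?_
  split_ifs
  · exact tendsto_scaledAvg integrable_gauss (hΨ.mono fun _ h => continuous_rightDatum α h)
      (hM.mono fun _ h => abs_rightDatum_le hα h)
      (fun y => (hlim y).add (((hlim _).sub (hlim _)).const_mul _)) t x
  · exact tendsto_scaledAvg integrable_gauss (hΨ.mono fun _ h => continuous_leftDatum α h)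
      (hM.mono fun _ h => abs_leftDatum_le hα h)
      (fun y => (hlim y).sub (((hlim _).sub (hlim _)).const_mul _)) t x

end Evolution

/-! ### Flows and classical solutions -/

theorem IsTransmissionFlow.isSolution {α : ℝ} {w wx wxx : ℝ → ℝ → ℝ}
    (h : IsTransmissionFlow α w wx wxx)
    (cx : ContinuousOn (fun p : ℝ × ℝ => wx p.1 p.2) (Ioi 0 ×ˢ {0}ᶜ))
    (cxx : ContinuousOn (fun p : ℝ × ℝ => wxx p.1 p.2) (Ioi 0 ×ˢ {0}ᶜ)) :
    IsSolution α (w 0) w := by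
  have e1 : ∀ t x, 0 < t → x ≠ 0 → deriv (w t) x = wx t x := fun t x ht hx =>
    (h.hasDerivAt_x t x ht hx).deriv
  have e1' : ∀ t x, 0 < t → x ≠ 0 → deriv (w t) =ᶠ[𝓝 x] wx t := fun t x ht hx =>
    (eventually_ne_nhds hx).mono fun y hy => e1 t y ht hy
  have h2 : ∀ t x, 0 < t → x ≠ 0 → HasDerivAt (deriv (w t)) (wxx t x) x := fun t x ht hx =>
    (h.hasDerivAt_xx t x ht hx).congr_of_eventuallyEq (e1' t x ht hx)
  have e0 : ∀ t x, 0 < t → x ≠ 0 → deriv (fun s => w s x) t = 1 / 2 * wxx t x :=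
    fun t x ht hx => (h.hasDerivAt_t t x ht hx).deriv
  have c0 : ContinuousOn (fun p : ℝ × ℝ => w p.1 p.2) (Ioi 0 ×ˢ univ) :=
    h.cont.mono (prod_mono Ioi_subset_Ici_self subset_rfl)
  refine ⟨⟨fun t x ht hx => (h.hasDerivAt_t t x ht hx).differentiableAt,
    fun t x ht hx => (h.hasDerivAt_x t x ht hx).differentiableAt,
    fun t x ht hx => (h2 t x ht hx).differentiableAt,
    c0.mono (prod_mono subset_rfl (subset_univ _)), ?_, ?_, ?_⟩, c0, ?_, ?_, fun _ => rfl, ?_⟩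
  · exact (cxx.const_mul (1 / 2)).congr fun p hp => e0 p.1 p.2 hp.1 hp.2
  · exact cx.congr fun p hp => e1 p.1 p.2 hp.1 hp.2
  · exact cxx.congr fun p hp => (h2 p.1 p.2 hp.1 hp.2).deriv
  · intro t x ht hx
    rw [e0 t x ht hx, (h2 t x ht hx).deriv]
  · intro t ht
    obtain ⟨dr, dl, hr, hl, hd⟩ := h.transmission t ht
    refine ⟨dr, dl, hr.congr' ?_, hl.congr' ?_, hd⟩
    · filter_upwards [self_mem_nhdsWithin] with y hy using (e1 t y ht (ne_of_gt hy)).symm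
    · filter_upwards [self_mem_nhdsWithin] with y hy using (e1 t y ht (ne_of_lt hy)).symm
  · intro x
    have hc : ContinuousOn (fun t => w t x) (Ici 0) :=
      h.cont.comp (f := fun t : ℝ => (t, x)) (by fun_prop) fun t ht => ⟨ht, mem_univ _⟩
    exact (hc 0 self_mem_Ici).mono_left (nhdsWithin_mono _ Ioi_subset_Ici_self)

/-- A classical solution restarted at a positive time is continuous up to its initial time. -/
theorem IsSolution.isTransmissionFlow_shift {α : ℝ} {φ : ℝ → ℝ} {v : ℝ → ℝ → ℝ}
    (h : IsSolution α φ v) {s : ℝ} (hs : 0 < s) :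
    IsTransmissionFlow α (fun t => v (s + t)) (fun t => deriv (v (s + t)))
      (fun t => deriv (deriv (v (s + t)))) where
  hasDerivAt_x t x ht hx := (h.c12.diff_x (s + t) x (by positivity) hx).hasDerivAt
  hasDerivAt_xx t x ht hx := (h.c12.diff_xx (s + t) x (by positivity) hx).hasDerivAt
  hasDerivAt_t t x ht hx := by
    rw [← h.heat (s + t) x (by positivity) hx]
    have h1 : HasDerivAt (fun r => s + r) 1 t := (hasDerivAt_id t).const_add s
    simpa [Function.comp_def] using
      (h.c12.diff_t (s + t) x (by positivity) hx).hasDerivAt.comp t h1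
  cont := h.cont.comp (f := fun p : ℝ × ℝ => (s + p.1, p.2)) (by fun_prop)
    fun p hp => ⟨add_pos_of_pos_of_nonneg hs hp.1, mem_univ _⟩
  transmission t ht := h.transmission (s + t) (by positivity)

theorem IsSolution.continuous_slice {α : ℝ} {φ : ℝ → ℝ} {v : ℝ → ℝ → ℝ} (h : IsSolution α φ v)
    {s : ℝ} (hs : 0 < s) : Continuous (v s) :=
  h.cont.comp_continuous (f := fun x : ℝ => (s, x)) (by fun_prop) fun _ => ⟨hs, mem_univ _⟩

/-- Every solution bounded on strips is the evolution of its datum. As the datum is attained only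
pointwise, the comparison takes place from a time `s > 0` on, and then `s ↓ 0` by dominated
convergence. -/
theorem IsSolution.eq_skewEvolution {α : ℝ} (hα : α ∈ Icc (0 : ℝ) 1) {φ : ℝ → ℝ}
    {v : ℝ → ℝ → ℝ} (h : IsSolution α φ v) (hb : BoundedOnStrips v) {t x : ℝ} (ht : 0 ≤ t) :
    v t x = skewEvolution α φ t x := by
  rcases ht.eq_or_lt with rfl | ht'
  · rw [h.initial, skewEvolution_zero]
  have restart : ∀ s, 0 < s → v (s + t) x = skewEvolution α (v s) t x := by
    intro s hs
    obtain ⟨B, hB⟩ := hb s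
    have hM : ∀ y, |v s y| ≤ B := fun y => hB s y hs.le le_rfl
    refine (h.isTransmissionFlow_shift hs).eq_of_initial_eq hα
      (isTransmissionFlow_skewEvolution hα (h.continuous_slice hs) hM) (fun T => ?_)
      (boundedOnStrips_skewEvolution hα hM) (fun y => ?_) ht
    · obtain ⟨C, hC⟩ := hb (s + T)
      exact ⟨C, fun r y hr hrT => hC (s + r) y (by positivity) (by linarith)⟩
    · simp only [add_zero, skewEvolution_zero]
  obtain ⟨B, hB⟩ := hb 1
  have lim1 : Tendsto (fun s => skewEvolution α (v s) t x) (𝓝[>] 0)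
      (𝓝 (skewEvolution α φ t x)) := by
    refine tendsto_skewEvolution hα (M := B) ?_ ?_ h.initial_limit t x
    · filter_upwards [self_mem_nhdsWithin] with s hs using h.continuous_slice hs
    · filter_upwards [Ioo_mem_nhdsGT (zero_lt_one (α := ℝ))] with s hs y
      exact hB s y hs.1.le hs.2.le
  have lim2 : Tendsto (fun s => v (s + t) x) (𝓝[>] 0) (𝓝 (v t x)) := by
    have hc : ContinuousAt (fun p : ℝ × ℝ => v p.1 p.2) (t, x) :=
      h.cont.continuousAt (prod_mem_nhds (Ioi_mem_nhds ht') univ_mem)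
    have hs : Tendsto (fun s : ℝ => (s + t, x)) (𝓝[>] 0) (𝓝 (t, x)) := by
      have : Tendsto (fun s : ℝ => (s + t, x)) (𝓝 0) (𝓝 (0 + t, x)) :=
        Continuous.tendsto (by fun_prop) 0
      rw [zero_add] at this
      exact this.mono_left nhdsWithin_le_nhds
    exact hc.tendsto.comp hs
  refine tendsto_nhds_unique lim2 (lim1.congr' ?_)
  filter_upwards [self_mem_nhdsWithin] with s hs using (restart s hs).symm

end SkewHeat

theorem proposition1 (α : ℝ) (hα : α ∈ Set.Icc (0 : ℝ) 1) (φ : ℝ → ℝ) (hφ : Continuous φ)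
    (hφb : ∃ C : ℝ, ∀ x : ℝ, |φ x| ≤ C) :
    ∃ u : ℝ → ℝ → ℝ,
      SkewHeat.IsSolution α φ u ∧
      ContinuousOn (fun p : ℝ × ℝ => u p.1 p.2) (Set.Ici 0 ×ˢ Set.univ) ∧
      SkewHeat.MaximumPrinciple φ u ∧
      ∀ v : ℝ → ℝ → ℝ, SkewHeat.IsSolution α φ v → SkewHeat.BoundedOnStrips v →
        ∀ t x : ℝ, 0 ≤ t → v t x = u t x := by
  obtain ⟨M, hM⟩ := hφb
  have hflow := SkewHeat.isTransmissionFlow_skewEvolution hα hφ hM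
  have hsol := hflow.isSolution (SkewHeat.continuousOn_skewEvolutionX hα hφ hM)
    (SkewHeat.continuousOn_skewEvolutionXX hα hφ hM)
  rw [show SkewHeat.skewEvolution α φ 0 = φ from funext (SkewHeat.skewEvolution_zero α φ)] at hsol
  exact ⟨SkewHeat.skewEvolution α φ, hsol, hflow.cont,
    SkewHeat.maximumPrinciple_skewEvolution hα hφ hM,
    fun v hv hb t x ht => hv.eq_skewEvolution hα hb ht⟩
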